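/- Let $d\in\mathbb N$ and work in $\mathbb R^d$ with the Euclidean norm; $B(x,\delta)$ is the open ball and $N_\delta(F)$ is the least number of balls of radius $\delta$ needed to cover a bounded set $F$. For $F\subset\mathbb R^d$ and $\theta\in(0,1)$, the Assouad spectrum is $$\dim_A^\theta F=\inf\Bigl\{a\in\mathbb R:(\exists M>0)(\forall\, 0<\delta\le 1)(\forall x\in F)\ N_{\delta^{1/\theta}}(F\cap B(x,\delta))\le M\Bigl(\frac{\delta}{\delta^{1/\theta}}\Bigr)^a\Bigr\},$$ and the Assouad dimension is $$\dim_A F=\inf\Bigl\{a\in\mathbb R:(\exists M>0)(\forall\, 0<\delta'<\delta)(\forall x\in F)\ N_{\delta'}(F\cap B(x,\delta))\le M\Bigl(\frac{\delta}{\delta'}\Bigr)^a\Bigr\}.$$ Let $\mathcal A_d$ be the set of functions $\varphi\colon(0,1)\to[0,d]$ such that for all $0<\lambda<\theta<1$ $$0\le(1-\lambda)\varphi(\lambda)-(1-\theta)\varphi(\theta)\le(\theta-\lambda)\,\varphi\Bigl(\frac{\lambda}{\theta}\Bigr).$$ A homogeneous Moran set in $\mathbb R^d$ is a set of the form $$C=\bigcap_{n=1}^\infty\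 \bigcup_{(\boldsymbol i_1,\dots,\boldsymbol i_n)\in(\{0,1\}^d)^n}S^1_{\boldsymbol i_1}\circ\cdots\circ S^n_{\boldsymbol i_n}([0,1]^d),$$ where $(r_n)_{n\ge1}\subset(0,1/2]$ and $S^n_{\boldsymbol i}(x)=r_nx+(1-r_n)\boldsymbol i$ for $\boldsymbol i\in\{0,1\}^d\subset\mathbb R^d$. Theorem. Let $\varphi\in\mathcal A_d$. Then the limit $\varphi(1):=\lim_{\theta\to1^-}\varphi(\theta)$ exists, and for every $\alpha\in\mathbb R$ with $\varphi(1)\le\alpha\le d$ there is a homogeneous Moran set $C\subset\mathbb R^d$ such that $\dim_A C=\alpha$ and $\dim_A^\theta C=\varphi(\theta)$ for all $\theta\in(0,1)$. -/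

import Mathlib

open Set Filter Topology

noncomputable section

namespace AssouadSpectra

/-- `ℝ^d` with the Euclidean norm. -/
abbrev E (d : ℕ) : Type := EuclideanSpace ℝ (Fin d)

/-- The class `𝒜_d` of functions `φ : (0,1) → [0,d]` such that
`0 ≤ (1-s)φ(s) - (1-t)φ(t) ≤ (t-s)φ(s/t)` for all `0 < s < t < 1`.
Functions on `(0,1)` are represented by functions on `ℝ` whose values off `(0,1)` are ignored. -/
def classA (d : ℕ) : Set (ℝ → ℝ) :=
  {φ | (∀ t ∈ Ioo (0 : ℝ) 1, φ t ∈ Icc (0 : ℝ) d) ∧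
    ∀ s t : ℝ, 0 < s → s < t → t < 1 →
      0 ≤ (1 - s) * φ s - (1 - t) * φ t ∧
      (1 - s) * φ s - (1 - t) * φ t ≤ (t - s) * φ (s / t)}

/-- `N_δ(F)`: the least number of open balls of radius `δ` that cover `F`
(for bounded `F` and `δ > 0` a finite cover exists, see `exists_cover`). -/
def coverNum {d : ℕ} (δ : ℝ) (F : Set (E d)) : ℕ :=
  sInf {n | ∃ t : Finset (E d), t.card = n ∧ F ⊆ ⋃ x ∈ t, Metric.ball x δ}

theorem exists_cover {d : ℕ} {δ : ℝ} (hδ : 0 < δ) {F : Set (E d)}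
    (hF : Bornology.IsBounded F) :
    ∃ t : Finset (E d), t.card = coverNum δ F ∧ F ⊆ ⋃ x ∈ t, Metric.ball x δ := by
  have hne : {n | ∃ t : Finset (E d), t.card = n ∧
      F ⊆ ⋃ x ∈ t, Metric.ball x δ}.Nonempty := by
    obtain ⟨t, ht, hsub⟩ := Metric.totallyBounded_iff.1
      (hF.isCompact_closure.totallyBounded.subset subset_closure) δ hδ
    exact ⟨_, ht.toFinset, rfl, by simpa using hsub⟩
  exact Nat.sInf_mem hne

/-- The Assouad spectrum of `F` at `θ`; the infimum of the admissible real exponents is taken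
in the extended reals. -/
def assouadSpectrum {d : ℕ} (θ : ℝ) (F : Set (E d)) : EReal :=
  ⨅ a ∈ {a : ℝ | ∃ C : ℝ, 0 < C ∧ ∀ δ : ℝ, 0 < δ → δ ≤ 1 → ∀ x ∈ F,
    (coverNum (δ ^ (1 / θ)) (F ∩ Metric.ball x δ) : ℝ) ≤ C * (δ / δ ^ (1 / θ)) ^ a}, (a : EReal)

/-- The Assouad dimension of `F`; the infimum of the admissible real exponents is taken
in the extended reals. -/
def assouadDim {d : ℕ} (F : Set (E d)) : EReal :=
  ⨅ a ∈ {a : ℝ | ∃ C : ℝ, 0 < C ∧ ∀ δ' δ : ℝ, 0 < δ' → δ' < δ → ∀ x ∈ F,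
    (coverNum δ' (F ∩ Metric.ball x δ) : ℝ) ≤ C * (δ / δ') ^ a}, (a : EReal)

/-- The similarity `x ↦ ρ x + b` where `b` has `j`-th coordinate `1 - ρ` if `i j` is `true`
and `0` otherwise. -/
def moranMap {d : ℕ} (ρ : ℝ) (i : Fin d → Bool) (x : E d) : E d :=
  ρ • x + WithLp.toLp 2 (fun j => if i j then 1 - ρ else 0)

/-- The composition `S_σ = S^1_{σ_1} ∘ ⋯ ∘ S^n_{σ_n}` for a word `σ` of length `n`,
where the ratio of the maps of level `n + 1` is `r n`. -/
def wordMap {d : ℕ} (r : ℕ → ℝ) : (n : ℕ) → (Fin n → (Fin d → Bool)) → E d → E d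
  | 0, _ => id
  | n + 1, σ => wordMap r n (Fin.init σ) ∘ moranMap (r n) (σ (Fin.last n))

/-- The cube `[0,1]^d`. -/
def unitCube (d : ℕ) : Set (E d) := {x | ∀ j, x j ∈ Icc (0 : ℝ) 1}

/-- The set `C(r) = ⋂_{n ≥ 1} ⋃_{σ of length n} S_σ([0,1]^d)`. -/
def moranSet (d : ℕ) (r : ℕ → ℝ) : Set (E d) :=
  ⋂ n : ℕ, ⋃ σ : Fin (n + 1) → (Fin d → Bool), wordMap r (n + 1) σ '' unitCube d

/-- Homogeneous Moran sets in `ℝ^d`: the sets `C(r)` with all ratios in `(0,1/2]`. -/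
def IsHomogeneousMoranSet {d : ℕ} (C : Set (E d)) : Prop :=
  ∃ r : ℕ → ℝ, (∀ n, r n ∈ Ioc (0 : ℝ) (1 / 2)) ∧ C = moranSet d r

end AssouadSpectra

end

/-! Put g(θ) = (1-θ)φ(θ). The class condition says that g is nonincreasing and that g(s) - g(t) ≤ t
g(s/t). In logarithmic scale a homogeneous Moran set C is governed by one function f: up to
constants, N_{e^{-t}}(C ∩ B(x, e^{-s})) is at most e^{f(t)-f(s)} for all x, and at least this at x =
0 when s ≥ 0. For d ≥ 1, every nondecreasing unbounded d-Lipschitz f vanishing on (-∞,0] arises so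
(`exists_moranSet_of_profile`). The spectrum at θ is then the upper limit of (f(t)-f(θt))/((1-θ)t),
and the Assouad dimension is the largest slope of f over long intervals.

It remains to build f (`profile`). With T_k = ((k+1)!)^3, on [T_k/(k+1), T_k] let f equal
T_k(g(1/(k+1)) - g(t/T_k)) up to an additive constant. Then f(T_k) - f(θT_k) = T_k g(θ) once 1/(k+1)
≤ θ, so the value φ(θ) is attained. The inequality for g shows that no window [θt, t] does better in
a block (`main_block_sub_le`), and the blocks are so sparse that late windows meet only one
(`profile_spectrum_upper`).

After T_k comes a segment of length k+1 and slope max(α, 1/(k+1)). Its length tends to infinity,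
which forces Assouad dimension at least α, but is o(T_k), hence invisible to the spectrum. The main
parts are no steeper: g(s) - g(t) ≤ (t-s)φ(s/t) ≤ φ(1)(t-s), because φ(1) is the supremum of φ
(`exists_limit_of_classA`). -/

namespace AssouadSpectra

/-! ### The class 𝒜_d and the limit at 1 -/

/-- The normalised increment `(1-θ)φ(θ)` of a spectrum. -/
noncomputable def incr (φ : ℝ → ℝ) (θ : ℝ) : ℝ := (1 - θ) * φ θ

@[simp] theorem incr_one (φ : ℝ → ℝ) : incr φ 1 = 0 := by simp [incr]

theorem incr_nonneg {d : ℕ} {φ : ℝ → ℝ} (hφ : φ ∈ classA d) {t : ℝ} (h0 : 0 < t) (h1 : t ≤ 1) :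
    0 ≤ incr φ t := by
  rcases h1.eq_or_lt with rfl | h1
  · simp
  · exact mul_nonneg (by linarith) (hφ.1 t ⟨h0, h1⟩).1

theorem incr_anti {d : ℕ} {φ : ℝ → ℝ} (hφ : φ ∈ classA d) {s t : ℝ} (h0 : 0 < s) (hst : s ≤ t)
    (h1 : t ≤ 1) : incr φ t ≤ incr φ s := by
  rcases hst.eq_or_lt with rfl | hst
  · rfl
  rcases h1.eq_or_lt with rfl | h1
  · simpa using incr_nonneg hφ h0 hst.le
  · have := (hφ.2 s t h0 hst h1).1
    unfold incr
    linarith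

theorem incr_sub_le {d : ℕ} {φ : ℝ → ℝ} (hφ : φ ∈ classA d) {s t : ℝ} (h0 : 0 < s) (hst : s ≤ t)
    (h1 : t ≤ 1) : incr φ s - incr φ t ≤ t * incr φ (s / t) := by
  have ht : 0 < t := h0.trans_le hst
  rcases hst.eq_or_lt with rfl | hst
  · simp [div_self h0.ne']
  rcases h1.eq_or_lt with rfl | h1
  · simp
  · have := (hφ.2 s t h0 hst h1).2
    have e : t * incr φ (s / t) = (t - s) * φ (s / t) := by
      unfold incr
      field_simp
    rw [e]
    exact this

/-- Telescoping along the powers of θ: passing from θ^n to θ^(n+1) adds at most θ^n g(θ), which sums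
to a geometric series. -/
theorem incr_pow_le {d : ℕ} {φ : ℝ → ℝ} (hφ : φ ∈ classA d) {θ : ℝ} (h0 : 0 < θ) (h1 : θ < 1)
    (n : ℕ) : incr φ (θ ^ n) ≤ (1 - θ ^ n) * φ θ := by
  induction n with
  | zero => simp
  | succ n ih =>
    have hp : 0 < θ ^ n := by positivity
    have := incr_sub_le hφ (s := θ ^ (n + 1)) (t := θ ^ n) (by positivity)
      (pow_le_pow_of_le_one h0.le h1.le n.le_succ) (pow_le_one₀ h0.le h1.le)
    have e : θ ^ (n + 1) / θ ^ n = θ := by rw [pow_succ, mul_div_cancel_left₀ _ hp.ne']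
    rw [e] at this
    have e2 : incr φ θ = (1 - θ) * φ θ := rfl
    rw [e2] at this
    rw [pow_succ] at *
    nlinarith

/-- Sandwich s between consecutive powers of θ. As θ → 1 the two factors agree in the limit, so φ(s)
≤ liminf φ. -/
theorem le_of_classA {d : ℕ} {φ : ℝ → ℝ} (hφ : φ ∈ classA d) {s θ : ℝ} (hs0 : 0 < s)
    (hs1 : s < 1) (h0 : 0 < θ) (h1 : θ < 1) : (1 - s) * φ s ≤ (1 - s * θ) * φ θ := by
  obtain ⟨n, hn1, hn2⟩ := exists_nat_pow_near_of_lt_one hs0 hs1.le h0 h1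
  have hφθ := (hφ.1 θ ⟨h0, h1⟩).1
  have h2 : s * θ ≤ θ ^ (n + 1) := by
    rw [pow_succ]
    exact mul_le_mul_of_nonneg_right hn2 h0.le
  calc (1 - s) * φ s = incr φ s := rfl
    _ ≤ incr φ (θ ^ (n + 1)) := incr_anti hφ (by positivity) hn1.le hs1.le
    _ ≤ (1 - θ ^ (n + 1)) * φ θ := incr_pow_le hφ h0 h1 _
    _ ≤ (1 - s * θ) * φ θ := mul_le_mul_of_nonneg_right (by linarith) hφθ

/-- A function in `𝒜_d` converges at `1` to its supremum. -/
theorem exists_limit_of_classA {d : ℕ} {φ : ℝ → ℝ} (hφ : φ ∈ classA d) :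
    ∃ φ₁ : ℝ, Tendsto φ (𝓝[<] 1) (𝓝 φ₁) ∧ ∀ θ ∈ Ioo (0 : ℝ) 1, φ θ ≤ φ₁ := by
  have hbdd : BddAbove (φ '' Ioo 0 1) := ⟨d, by
    rintro _ ⟨t, ht, rfl⟩
    exact (hφ.1 t ht).2⟩
  have hle : ∀ θ ∈ Ioo (0 : ℝ) 1, φ θ ≤ sSup (φ '' Ioo 0 1) :=
    fun θ hθ => le_csSup hbdd (mem_image_of_mem _ hθ)
  have hmem : Ioo (0 : ℝ) 1 ∈ 𝓝[<] (1 : ℝ) := Ioo_mem_nhdsLT zero_lt_one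
  refine ⟨_, ?_, hle⟩
  rw [tendsto_order]
  constructor
  · intro b hb
    obtain ⟨_, ⟨s, hs, rfl⟩, hbs⟩ := exists_lt_of_lt_csSup
      ((nonempty_Ioo.2 zero_lt_one).image φ) hb
    have hlim : Tendsto (fun θ : ℝ => (1 - s) * φ s / (1 - s * θ)) (𝓝[<] 1) (𝓝 (φ s)) := by
      have hs' : 1 - s ≠ 0 := by linarith [hs.2]
      have : ContinuousAt (fun θ : ℝ => (1 - s) * φ s / (1 - s * θ)) 1 := by
        refine ContinuousAt.div (by fun_prop) (by fun_prop) (by simpa using hs')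
      have h2 := this.tendsto
      simp only [mul_one] at h2
      rw [mul_div_cancel_left₀ _ hs'] at h2
      exact h2.mono_left nhdsWithin_le_nhds
    filter_upwards [hlim.eventually (lt_mem_nhds hbs), hmem] with θ h1 hθ
    refine h1.trans_le ?_
    have : 0 < 1 - s * θ := by nlinarith [hs.1, hs.2, hθ.1, hθ.2]
    rw [div_le_iff₀ this, mul_comm (φ θ)]
    exact le_of_classA hφ hs.1 hs.2 hθ.1 hθ.2
  · intro b hb
    filter_upwards [hmem] with θ hθ
    exact (hle θ hθ).trans_lt hb

/-! ### Clamping and the positions of the blocks -/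

/-- The projection of the line to the interval `[a, b]`. -/
noncomputable def clamp (a b t : ℝ) : ℝ := max a (min t b)

theorem clamp_mono (a b : ℝ) : Monotone (clamp a b) :=
  fun _ _ h => max_le_max le_rfl (min_le_min h le_rfl)

theorem clamp_of_le_left {a b t : ℝ} (h : t ≤ a) : clamp a b t = a :=
  max_eq_left ((min_le_left _ _).trans h)

theorem clamp_of_right_le {a b t : ℝ} (hab : a ≤ b) (h : b ≤ t) : clamp a b t = b := by
  rw [clamp, min_eq_right h, max_eq_right hab]

theorem clamp_of_mem {a b t : ℝ} (h : t ∈ Icc a b) : clamp a b t = t := by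
  rw [clamp, min_eq_left h.2, max_eq_right h.1]

theorem left_le_clamp (a b t : ℝ) : a ≤ clamp a b t := le_max_left _ _

theorem clamp_le_right {a b : ℝ} (hab : a ≤ b) (t : ℝ) : clamp a b t ≤ b :=
  max_le hab (min_le_right _ _)

theorem clamp_add_clamp {a b c : ℝ} (hab : a ≤ b) (hbc : b ≤ c) (t : ℝ) :
    clamp a b t + clamp b c t = clamp a c t + b := by
  rcases le_total t b with h | h
  · rw [clamp_of_le_left h]
    simp only [clamp, min_eq_left h, min_eq_left (h.trans hbc)]
  · rw [clamp_of_right_le hab h, add_comm]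
    simp only [clamp]
    rw [max_eq_right (le_min h hbc), max_eq_right (hab.trans (le_min h hbc))]

/-- The position of the end of the main part of the `k`-th block. -/
noncomputable def blockTop (k : ℕ) : ℝ := ((k + 1).factorial : ℝ) ^ 3

/-- The position at which the `k`-th block starts. -/
noncomputable def blockStart (k : ℕ) : ℝ := blockTop k / (k + 1)

/-- The position at which the `k`-th block ends. -/
noncomputable def blockEnd (k : ℕ) : ℝ := blockTop k + (k + 1)

theorem cube_le_blockTop (k : ℕ) : ((k : ℝ) + 1) ^ 3 ≤ blockTop k := by
  unfold blockTop
  gcongr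
  exact_mod_cast Nat.self_le_factorial (k + 1)

theorem sq_le_blockTop (k : ℕ) : ((k : ℝ) + 1) ^ 2 ≤ blockTop k :=
  (pow_le_pow_right₀ (by linarith [k.cast_nonneg (α := ℝ)]) (by norm_num)).trans
    (cube_le_blockTop k)

theorem le_blockTop (k : ℕ) : (k : ℝ) + 1 ≤ blockTop k := by
  nlinarith [sq_le_blockTop k, k.cast_nonneg (α := ℝ)]

theorem blockTop_pos (k : ℕ) : 0 < blockTop k := by
  linarith [le_blockTop k, k.cast_nonneg (α := ℝ)]

theorem blockTop_succ (k : ℕ) : blockTop (k + 1) = ((k : ℝ) + 2) ^ 3 * blockTop k := by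
  unfold blockTop
  rw [Nat.factorial_succ (k + 1)]
  push_cast
  ring

theorem le_blockStart (k : ℕ) : (k : ℝ) + 1 ≤ blockStart k := by
  unfold blockStart
  rw [le_div_iff₀ (by positivity)]
  nlinarith [sq_le_blockTop k]

theorem blockStart_le_blockTop (k : ℕ) : blockStart k ≤ blockTop k :=
  div_le_self (blockTop_pos k).le (by linarith [k.cast_nonneg (α := ℝ)])

theorem blockTop_le_blockEnd (k : ℕ) : blockTop k ≤ blockEnd k := by
  unfold blockEnd
  linarith [k.cast_nonneg (α := ℝ)]

theorem blockStart_le_blockEnd (k : ℕ) : blockStart k ≤ blockEnd k :=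
  (blockStart_le_blockTop k).trans (blockTop_le_blockEnd k)

theorem blockEnd_pos (k : ℕ) : 0 < blockEnd k :=
  (blockTop_pos k).trans_le (blockTop_le_blockEnd k)

/-- Here `blockStart (k + 1)` is (k+2)² T_k while `blockEnd k` is at most 2T_k. The growing ratio
separates the blocks multiplicatively. -/
theorem mul_blockEnd_le (k : ℕ) : ((k : ℝ) + 1) * blockEnd k ≤ blockStart (k + 1) := by
  have h1 := le_blockTop k
  have hk := k.cast_nonneg (α := ℝ)
  have : blockStart (k + 1) = ((k : ℝ) + 2) ^ 2 * blockTop k := by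
    rw [blockStart, blockTop_succ]
    push_cast
    field_simp
    ring
  rw [this, blockEnd]
  calc ((k : ℝ) + 1) * (blockTop k + (k + 1)) ≤ (k + 1) * (blockTop k + blockTop k) := by gcongr
    _ = (2 * k + 2) * blockTop k := by ring
    _ ≤ (k + 2) ^ 2 * blockTop k :=
        mul_le_mul_of_nonneg_right (by nlinarith) (blockTop_pos k).le

theorem blockEnd_le_blockStart_succ (k : ℕ) : blockEnd k ≤ blockStart (k + 1) := by
  nlinarith [mul_blockEnd_le k, blockEnd_pos k, k.cast_nonneg (α := ℝ)]

theorem blockStart_mono : Monotone blockStart :=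
  monotone_nat_of_le_succ fun k =>
    (blockStart_le_blockEnd k).trans (blockEnd_le_blockStart_succ k)

theorem blockEnd_mono : Monotone blockEnd :=
  monotone_nat_of_le_succ fun k =>
    (blockEnd_le_blockStart_succ k).trans (blockStart_le_blockEnd (k + 1))

theorem sum_clamp_sub_le {s t : ℝ} (hst : s ≤ t) (n : ℕ) :
    ∑ k ∈ Finset.range n, (clamp (blockStart k) (blockEnd k) t -
      clamp (blockStart k) (blockEnd k) s) ≤ t - s := by
  -- Truncation at the start of block n closes the induction: the first n blocks lie to its left.
  suffices h : ∑ k ∈ Finset.range n, (clamp (blockStart k) (blockEnd k) t -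
      clamp (blockStart k) (blockEnd k) s) ≤ min t (blockStart n) - min s (blockStart n) by
    refine h.trans ?_
    rcases le_total t (blockStart n) with h1 | h1 <;>
      rcases le_total s (blockStart n) with h2 | h2 <;> simp [h1, h2] <;> linarith
  induction n with
  | zero =>
    simpa using Or.inl hst
  | succ n ih =>
    rw [Finset.sum_range_succ]
    have key : clamp (blockStart n) (blockEnd n) t - clamp (blockStart n) (blockEnd n) s ≤
        clamp (blockStart n) (blockStart (n + 1)) t -
          clamp (blockStart n) (blockStart (n + 1)) s := by
      have h1 := clamp_add_clamp (blockStart_le_blockEnd n) (blockEnd_le_blockStart_succ n) t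
      have h2 := clamp_add_clamp (blockStart_le_blockEnd n) (blockEnd_le_blockStart_succ n) s
      have h3 := clamp_mono (blockEnd n) (blockStart (n + 1)) hst
      linarith
    have hmm : ∀ u, min u (blockStart n) + clamp (blockStart n) (blockStart (n + 1)) u =
        min u (blockStart (n + 1)) + blockStart n := by
      intro u
      have hle := blockStart_mono n.le_succ
      rcases le_total u (blockStart n) with h | h
      · rw [clamp_of_le_left h, min_eq_left h, min_eq_left (h.trans hle)]
      · rw [clamp, min_eq_right h, max_eq_right (le_min h hle), add_comm]
    linarith [hmm t, hmm s]

/-! ### Blocks and their sum, the profile -/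

/-- The `k`-th block of the profile: the increment prescribed by `φ`, followed by a short
segment of slope close to `α`. -/
noncomputable def block (φ : ℝ → ℝ) (α : ℝ) (k : ℕ) (t : ℝ) : ℝ :=
  blockTop k * (incr φ (1 / (k + 1)) - incr φ (clamp (1 / (k + 1)) 1 (t / blockTop k))) +
    max α (1 / (k + 1)) * (clamp (blockTop k) (blockEnd k) t - blockTop k)

/-- The profile with spectrum `φ` and maximal slope `α`. -/
noncomputable def profile (φ : ℝ → ℝ) (α : ℝ) (t : ℝ) : ℝ :=
  ∑ k ∈ Finset.range ⌈t⌉₊, block φ α k t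

theorem inv_succ_mem (k : ℕ) : (0 : ℝ) < 1 / (k + 1) ∧ (1 : ℝ) / (k + 1) ≤ 1 := by
  refine ⟨by positivity, ?_⟩
  rw [div_le_one (by positivity)]
  linarith [k.cast_nonneg (α := ℝ)]

theorem clamp_div_mem (k : ℕ) (t : ℝ) :
    0 < clamp (1 / ((k : ℝ) + 1)) 1 t ∧ clamp (1 / ((k : ℝ) + 1)) 1 t ≤ 1 :=
  ⟨(inv_succ_mem k).1.trans_le (left_le_clamp _ _ _), clamp_le_right (inv_succ_mem k).2 _⟩

theorem blockTop_mul_clamp (k : ℕ) (t : ℝ) :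
    blockTop k * clamp (1 / ((k : ℝ) + 1)) 1 (t / blockTop k) =
      clamp (blockStart k) (blockTop k) t := by
  have hp := blockTop_pos k
  rw [clamp, clamp, mul_max_of_nonneg _ _ hp.le, mul_min_of_nonneg _ _ hp.le, mul_one,
    mul_div_cancel₀ _ hp.ne', blockStart, mul_one_div]

theorem block_of_le {φ : ℝ → ℝ} {α : ℝ} {k : ℕ} {t : ℝ} (h : t ≤ blockStart k) :
    block φ α k t = 0 := by
  have h1 : t / blockTop k ≤ 1 / (k + 1) := by
    rw [div_le_iff₀ (blockTop_pos k), one_div_mul_eq_div]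
    exact h
  rw [block, clamp_of_le_left h1, clamp_of_le_left (h.trans (blockStart_le_blockTop k))]
  simp

theorem block_of_ge {φ : ℝ → ℝ} {α : ℝ} {k : ℕ} {t : ℝ} (h : blockEnd k ≤ t) :
    block φ α k t = block φ α k (blockEnd k) := by
  have h1 : ∀ u, blockEnd k ≤ u → 1 ≤ u / blockTop k := fun u hu => by
    rw [le_div_iff₀ (blockTop_pos k), one_mul]
    exact (blockTop_le_blockEnd k).trans hu
  rw [block, block, clamp_of_right_le (inv_succ_mem k).2 (h1 t h),
    clamp_of_right_le (inv_succ_mem k).2 (h1 _ le_rfl),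
    clamp_of_right_le (blockTop_le_blockEnd k) h,
    clamp_of_right_le (blockTop_le_blockEnd k) le_rfl]

section
variable {d : ℕ} {φ : ℝ → ℝ} {α φ₁ : ℝ}

theorem slope_nonneg (α : ℝ) (k : ℕ) : 0 ≤ max α (1 / ((k : ℝ) + 1)) :=
  (inv_succ_mem k).1.le.trans (le_max_right _ _)

theorem block_mono (hφ : φ ∈ classA d) (α : ℝ) (k : ℕ) : Monotone (block φ α k) := by
  intro s t hst
  have h1 : s / blockTop k ≤ t / blockTop k := div_le_div_of_nonneg_right hst (blockTop_pos k).le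
  have h2 := incr_anti hφ (clamp_div_mem k (s / blockTop k)).1 (clamp_mono _ _ h1)
    (clamp_div_mem k _).2
  have h3 := clamp_mono (blockTop k) (blockEnd k) hst
  unfold block
  have := slope_nonneg α k
  have := (blockTop_pos k).le
  gcongr

theorem incr_sub_le_mul (hφ : φ ∈ classA d) (hφ₁ : ∀ θ ∈ Ioo (0 : ℝ) 1, φ θ ≤ φ₁) {s t : ℝ}
    (h0 : 0 < s) (hst : s ≤ t) (h1 : t ≤ 1) : incr φ s - incr φ t ≤ φ₁ * (t - s) := by
  rcases hst.eq_or_lt with rfl | hst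
  · simp
  have ht := h0.trans hst
  have hd : s / t < 1 := (div_lt_one ht).2 hst
  have h2 := hφ₁ (s / t) ⟨by positivity, hd⟩
  calc incr φ s - incr φ t ≤ t * ((1 - s / t) * φ (s / t)) := incr_sub_le hφ h0 hst.le h1
    _ ≤ t * ((1 - s / t) * φ₁) := by
        have : 0 ≤ 1 - s / t := by linarith
        gcongr
    _ = φ₁ * (t - s) := by field_simp

/-- The main part has slope at most φ₁ ≤ α, and it is adjacent to the segment, so the two clamped
lengths add up to that of the whole block. -/
theorem block_sub_le (hφ : φ ∈ classA d) (hφ₁ : ∀ θ ∈ Ioo (0 : ℝ) 1, φ θ ≤ φ₁) (hα : φ₁ ≤ α)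
    (k : ℕ) {s t : ℝ} (hst : s ≤ t) :
    block φ α k t - block φ α k s ≤ max α (1 / (k + 1)) *
      (clamp (blockStart k) (blockEnd k) t - clamp (blockStart k) (blockEnd k) s) := by
  have hp := blockTop_pos k
  have h1 : s / blockTop k ≤ t / blockTop k := div_le_div_of_nonneg_right hst hp.le
  have hm := clamp_mono (1 / ((k : ℝ) + 1)) 1 h1
  have h2 := incr_sub_le_mul hφ hφ₁ (clamp_div_mem k (s / blockTop k)).1 hm (clamp_div_mem k _).2
  have h3 : φ₁ * (clamp (1 / ((k : ℝ) + 1)) 1 (t / blockTop k) -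
      clamp (1 / ((k : ℝ) + 1)) 1 (s / blockTop k)) ≤
      max α (1 / (k + 1)) * (clamp (1 / ((k : ℝ) + 1)) 1 (t / blockTop k) -
      clamp (1 / ((k : ℝ) + 1)) 1 (s / blockTop k)) :=
    mul_le_mul_of_nonneg_right (hα.trans (le_max_left _ _)) (sub_nonneg.2 hm)
  have h4 := mul_le_mul_of_nonneg_left (h2.trans h3) hp.le
  have e1 := clamp_add_clamp (blockStart_le_blockTop k) (blockTop_le_blockEnd k) t
  have e2 := clamp_add_clamp (blockStart_le_blockTop k) (blockTop_le_blockEnd k) s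
  rw [← blockTop_mul_clamp] at e1 e2
  have e3 : clamp (blockStart k) (blockEnd k) t - clamp (blockStart k) (blockEnd k) s =
      blockTop k * (clamp (1 / ((k : ℝ) + 1)) 1 (t / blockTop k) -
      clamp (1 / ((k : ℝ) + 1)) 1 (s / blockTop k)) +
      (clamp (blockTop k) (blockEnd k) t - clamp (blockTop k) (blockEnd k) s) := by linarith
  rw [e3, mul_add]
  unfold block
  linarith

/-- Clamping only brings the arguments closer in ratio: if the clamped values v < u differ, then u ≤
t/T_k and v ≥ θt/T_k. So v/u ≥ θ, and T_k(g(v) - g(u)) ≤ T_k u g(v/u) ≤ t g(θ). -/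
theorem main_block_sub_le (hφ : φ ∈ classA d) (k : ℕ) {θ t : ℝ} (h0 : 0 < θ) (h1 : θ < 1)
    (ht : 0 ≤ t) :
    blockTop k * (incr φ (clamp (1 / (k + 1)) 1 (θ * t / blockTop k)) -
      incr φ (clamp (1 / (k + 1)) 1 (t / blockTop k))) ≤ incr φ θ * t := by
  have hp := blockTop_pos k
  have hle : θ * t / blockTop k ≤ t / blockTop k := by
    gcongr
    nlinarith
  have hm := clamp_mono (1 / ((k : ℝ) + 1)) 1 hle
  have hvp := (clamp_div_mem k (θ * t / blockTop k)).1
  have hu1 := (clamp_div_mem k (t / blockTop k)).2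
  rcases hm.eq_or_lt with he | hlt
  · rw [he]
    simpa using mul_nonneg (incr_nonneg hφ h0 h1.le) ht
  have hu : clamp (1 / ((k : ℝ) + 1)) 1 (t / blockTop k) ≤ t / blockTop k := by
    rcases le_total (t / blockTop k) (1 / ((k : ℝ) + 1)) with h | h
    · rw [clamp_of_le_left h, clamp_of_le_left (hle.trans h)] at hlt
      exact absurd hlt (lt_irrefl _)
    · exact max_le h (min_le_left _ _)
  have hv : θ * t / blockTop k ≤ clamp (1 / ((k : ℝ) + 1)) 1 (θ * t / blockTop k) := by
    rcases le_total (θ * t / blockTop k) 1 with h | h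
    · rw [clamp, min_eq_left h]
      exact le_max_right _ _
    · rw [clamp_of_right_le (inv_succ_mem k).2 h] at hlt
      exact absurd hlt (not_lt.2 hu1)
  generalize clamp (1 / ((k : ℝ) + 1)) 1 (t / blockTop k) = u at *
  generalize clamp (1 / ((k : ℝ) + 1)) 1 (θ * t / blockTop k) = v at *
  have hup : 0 < u := hvp.trans hlt
  have hvu : θ ≤ v / u := by
    rw [le_div_iff₀ hup]
    refine le_trans ?_ hv
    rw [mul_div_assoc]
    gcongr
  have h3 := incr_anti hφ h0 hvu ((div_le_one hup).2 hlt.le)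
  calc blockTop k * (incr φ v - incr φ u) ≤ blockTop k * (u * incr φ (v / u)) := by
        gcongr
        exact incr_sub_le hφ hvp hlt.le hu1
    _ ≤ blockTop k * (t / blockTop k * incr φ θ) :=
        mul_le_mul_of_nonneg_left (mul_le_mul hu h3
          (incr_nonneg hφ (by positivity) ((div_le_one hup).2 hlt.le))
          (hup.le.trans hu)) hp.le
    _ = incr φ θ * t := by field_simp

/-- The segment contributes at most D(k+1), and nothing unless t > T_k ≥ (k+1)². Completing the
square bounds this by ηt plus a constant independent of k. -/
theorem block_sub_le_incr (hφ : φ ∈ classA d) (k : ℕ) {D η θ t : ℝ} (hαD : α ≤ D) (hD : 1 ≤ D)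
    (h0 : 0 < θ) (h1 : θ < 1) (ht : 0 ≤ t) (hη : 0 < η) :
    block φ α k t - block φ α k (θ * t) ≤ incr φ θ * t + (η * t + D ^ 2 / η) := by
  have hmain := main_block_sub_le hφ k h0 h1 ht
  have hs : max α (1 / ((k : ℝ) + 1)) ≤ D := max_le hαD ((inv_succ_mem k).2.trans hD)
  have hs0 := slope_nonneg α k
  have hseg : max α (1 / ((k : ℝ) + 1)) * (clamp (blockTop k) (blockEnd k) t -
      clamp (blockTop k) (blockEnd k) (θ * t)) ≤ η * t + D ^ 2 / η := by
    rcases le_total t (blockTop k) with h | h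
    · rw [clamp_of_le_left h, clamp_of_le_left (by nlinarith : θ * t ≤ blockTop k)]
      simp only [sub_self, mul_zero]
      positivity
    · have e1 := clamp_le_right (blockTop_le_blockEnd k) t
      have e2 := left_le_clamp (blockTop k) (blockEnd k) (θ * t)
      have e3 : clamp (blockTop k) (blockEnd k) t - clamp (blockTop k) (blockEnd k) (θ * t) ≤
          k + 1 := by
        have : blockEnd k = blockTop k + (k + 1) := rfl
        linarith
      have e0 : 0 ≤ clamp (blockTop k) (blockEnd k) t -
          clamp (blockTop k) (blockEnd k) (θ * t) :=
        sub_nonneg.2 (clamp_mono _ _ (by nlinarith))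
      have e4 : D * ((k : ℝ) + 1) ≤ η * ((k : ℝ) + 1) ^ 2 + D ^ 2 / η := by
        have : η * ((k : ℝ) + 1) ^ 2 + D ^ 2 / η - D * ((k : ℝ) + 1) =
            ((η * (k + 1) - D) ^ 2 + η * (k + 1) * D) / η := by
          field_simp
          ring
        have h2 : 0 ≤ ((η * ((k : ℝ) + 1) - D) ^ 2 + η * (k + 1) * D) / η := by positivity
        linarith
      have e5 : η * ((k : ℝ) + 1) ^ 2 ≤ η * t := by
        have := (sq_le_blockTop k).trans h
        gcongr
      have e6 := mul_le_mul hs e3 e0 (by linarith : (0 : ℝ) ≤ D)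
      linarith
  unfold block
  linarith

theorem block_blockTop_sub (k : ℕ) {θ : ℝ} (h0 : 1 / ((k : ℝ) + 1) ≤ θ)
    (h1 : θ < 1) :
    block φ α k (blockTop k) - block φ α k (θ * blockTop k) = incr φ θ * blockTop k := by
  have hp := blockTop_pos k
  have e1 : clamp (1 / ((k : ℝ) + 1)) 1 1 = 1 := clamp_of_mem ⟨(inv_succ_mem k).2, le_rfl⟩
  have e2 : clamp (1 / ((k : ℝ) + 1)) 1 θ = θ := clamp_of_mem ⟨h0, h1.le⟩
  rw [block, block, div_self hp.ne', mul_div_cancel_right₀ _ hp.ne', e1, e2,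
    clamp_of_le_left le_rfl, clamp_of_le_left (by nlinarith), incr_one]
  ring

theorem block_blockEnd_sub (k : ℕ) :
    block φ α k (blockEnd k) - block φ α k (blockTop k) = max α (1 / (k + 1)) * (k + 1) := by
  have hp := blockTop_pos k
  have h1 : 1 ≤ blockEnd k / blockTop k := by
    rw [le_div_iff₀ hp, one_mul]
    exact blockTop_le_blockEnd k
  rw [block, block, clamp_of_right_le (inv_succ_mem k).2 h1,
    clamp_of_right_le (inv_succ_mem k).2 (div_self hp.ne').ge,
    clamp_of_right_le (blockTop_le_blockEnd k) le_rfl, clamp_of_le_left le_rfl, blockEnd]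
  ring

/-- Block k starts no earlier than k+1, so the omitted blocks vanish at t; increments can thus be
computed over a common range. -/
theorem profile_eq_sum {t : ℝ} {n : ℕ} (h : t ≤ n) :
    profile φ α t = ∑ k ∈ Finset.range n, block φ α k t := by
  refine Finset.sum_subset (Finset.range_mono (Nat.ceil_le.2 h)) fun k _ hk => ?_
  refine block_of_le ?_
  have h1 := Nat.ceil_le.1 (not_lt.1 (Finset.mem_range.not.1 hk))
  linarith [le_blockStart k]

theorem profile_sub {s t : ℝ} {n : ℕ} (hs : s ≤ n) (ht : t ≤ n) :
    profile φ α t - profile φ α s =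
      ∑ k ∈ Finset.range n, (block φ α k t - block φ α k s) := by
  rw [profile_eq_sum hs, profile_eq_sum ht, Finset.sum_sub_distrib]

theorem profile_mono (hφ : φ ∈ classA d) (α : ℝ) : Monotone (profile φ α) := by
  intro s t hst
  obtain ⟨n, hn⟩ := exists_nat_ge t
  rw [← sub_nonneg, profile_sub (hst.trans hn) hn]
  exact Finset.sum_nonneg fun k _ => sub_nonneg.2 (block_mono hφ α k hst)

theorem profile_of_nonpos {t : ℝ} (h : t ≤ 0) : profile φ α t = 0 := by
  simp [profile, Nat.ceil_eq_zero.2 h]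

theorem profile_nonneg (hφ : φ ∈ classA d) (α t : ℝ) : 0 ≤ profile φ α t := by
  rw [← profile_of_nonpos (φ := φ) (α := α) (min_le_right t 0)]
  exact profile_mono hφ α (min_le_left _ _)

theorem block_sub_le_profile_sub (hφ : φ ∈ classA d) (α : ℝ) (k : ℕ) {s t : ℝ} (hst : s ≤ t) :
    block φ α k t - block φ α k s ≤ profile φ α t - profile φ α s := by
  obtain ⟨n, hn⟩ := exists_nat_ge (max t (k + 1))
  have hn1 := (le_max_left _ _).trans hn
  have hn2 : k < n := by
    have := (le_max_right t ((k : ℝ) + 1)).trans hn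
    exact_mod_cast this
  rw [profile_sub (hst.trans hn1) hn1]
  exact Finset.single_le_sum (f := fun k => block φ α k t - block φ α k s)
    (fun k _ => sub_nonneg.2 (block_mono hφ α k hst)) (Finset.mem_range.2 hn2)

/-- Beyond the first blocks the profile has slope at most `a`. -/
theorem profile_sub_le_of_ge (hφ : φ ∈ classA d) (hφ₁ : ∀ θ ∈ Ioo (0 : ℝ) 1, φ θ ≤ φ₁)
    (hα : φ₁ ≤ α) {a b s t : ℝ} (ha : ∀ k, b < blockEnd k → max α (1 / ((k : ℝ) + 1)) ≤ a)
    (ha0 : 0 ≤ a) (hbs : b ≤ s) (hst : s ≤ t) :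
    profile φ α t - profile φ α s ≤ a * (t - s) := by
  obtain ⟨n, hn⟩ := exists_nat_ge t
  rw [profile_sub (hst.trans hn) hn]
  refine le_trans ?_ (mul_le_mul_of_nonneg_left (sum_clamp_sub_le hst n) ha0)
  rw [Finset.mul_sum]
  refine Finset.sum_le_sum fun k _ => ?_
  have hcl := sub_nonneg.2 (clamp_mono (blockStart k) (blockEnd k) hst)
  rcases lt_or_ge b (blockEnd k) with h | h
  · exact (block_sub_le hφ hφ₁ hα k hst).trans (mul_le_mul_of_nonneg_right (ha k h) hcl)
  · rw [block_of_ge (h.trans (hbs.trans hst)), block_of_ge (h.trans hbs), sub_self]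
    exact mul_nonneg ha0 hcl

/-- The lower bound 1/(k+1) on the slope makes each segment gain at least 1, even if φ and α vanish.
-/
theorem profile_tendsto (hφ : φ ∈ classA d) (α : ℝ) : Tendsto (profile φ α) atTop atTop := by
  refine tendsto_atTop_atTop_of_monotone (profile_mono hφ α) fun b => ?_
  obtain ⟨n, hn⟩ := exists_nat_ge b
  have key : ∀ k : ℕ, ((k : ℝ) + 1) ≤ profile φ α (blockEnd k) := by
    intro k
    have h1 : ∀ k : ℕ, 1 ≤ block φ α k (blockEnd k) - block φ α k (blockTop k) := fun k => by
      rw [block_blockEnd_sub]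
      have hk : (0 : ℝ) < k + 1 := by positivity
      calc (1 : ℝ) = 1 / (k + 1) * (k + 1) := by field_simp
        _ ≤ _ := mul_le_mul_of_nonneg_right (le_max_right _ _) hk.le
    induction k with
    | zero =>
      have := block_sub_le_profile_sub hφ α 0 (blockTop_le_blockEnd 0)
      have := profile_nonneg hφ α (blockTop 0)
      have := h1 0
      push_cast
      linarith
    | succ k ih =>
      have := block_sub_le_profile_sub hφ α (k + 1) (blockTop_le_blockEnd (k + 1))
      have := profile_mono hφ α ((blockEnd_le_blockStart_succ k).trans
        (blockStart_le_blockTop (k + 1)))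
      have := h1 (k + 1)
      push_cast at *
      linarith
  exact ⟨blockEnd n, by linarith [key n]⟩

/-! ### Spectrum and maximal slope of the profile -/

theorem profile_spectrum_upper (hφ : φ ∈ classA d) {D : ℝ} (hαD : α ≤ D) (hD : 1 ≤ D) {θ a : ℝ}
    (hθ : θ ∈ Ioo (0 : ℝ) 1) (ha : φ θ < a) :
    ∃ M, ∀ t, 0 ≤ t → profile φ α t - profile φ α (θ * t) ≤ a * ((1 - θ) * t) + M := by
  obtain ⟨h0, h1⟩ := hθ
  obtain ⟨K, hK⟩ := exists_nat_ge (1 / θ)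
  -- This choice of η makes g(θ)t + ηt equal to a(1-θ)t.
  have hη : 0 < (a - φ θ) * (1 - θ) := mul_pos (by linarith) (by linarith)
  set η := (a - φ θ) * (1 - θ) with hηdef
  have ha0 : 0 < a := (hφ.1 θ ⟨h0, h1⟩).1.trans_lt ha
  have hM1 : 0 ≤ D ^ 2 / η := by positivity
  have hM2 := profile_nonneg hφ α (blockEnd K / θ)
  -- The second summand absorbs all t ≤ `blockEnd K / θ`.
  refine ⟨D ^ 2 / η + profile φ α (blockEnd K / θ), fun t ht => ?_⟩
  have ht1 : 0 ≤ (1 - θ) * t := mul_nonneg (by linarith) ht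
  have hθt : θ * t ≤ t := by nlinarith
  rcases le_total t (blockEnd K / θ) with hT | hT
  · have := profile_mono hφ α hT
    have := profile_nonneg hφ α (θ * t)
    have := mul_nonneg ha0.le ht1
    linarith
  have hT' : blockEnd K ≤ θ * t := by
    rw [div_le_iff₀ h0] at hT
    linarith
  obtain ⟨n, hn⟩ := exists_nat_ge t
  rw [profile_sub (hθt.trans hn) hn]
  have hbound : ∀ k, block φ α k t - block φ α k (θ * t) ≤ a * ((1 - θ) * t) + D ^ 2 / η := by
    intro k
    refine (block_sub_le_incr hφ k hαD hD h0 h1 ht hη).trans (le_of_eq ?_)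
    rw [hηdef, incr]
    ring
  have hzero : ∀ k, block φ α k t - block φ α k (θ * t) ≠ 0 →
      blockStart k < t ∧ θ * t < blockEnd k := by
    intro k hk
    constructor
    · by_contra h
      rw [not_lt] at h
      exact hk (by rw [block_of_le h, block_of_le (hθt.trans h), sub_self])
    · by_contra h
      rw [not_lt] at h
      exact hk (by rw [block_of_ge h, block_of_ge (h.trans hθt), sub_self])
  -- Here k ≥ K, so (k+1)θ ≥ 1. If the window met both blocks, then t ≤ (k+1)θt ≤ (k+1)·`blockEnd k`
  -- ≤ `blockStart (k + 1)` ≤ `blockStart l` < t.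
  have hdisj : ∀ k l, k < l → blockStart l < t → θ * t < blockEnd k → False := by
    intro k l hkl hl hk
    have h2 := blockStart_mono (Nat.succ_le_of_lt hkl)
    have h3 := mul_blockEnd_le k
    have hKk : K ≤ k := by
      by_contra h
      have := blockEnd_mono (le_of_not_ge h)
      linarith
    have h4 : 1 / θ ≤ (k : ℝ) + 1 := by
      have : (K : ℝ) ≤ k := by exact_mod_cast hKk
      linarith
    rw [div_le_iff₀ h0] at h4
    have h5 : ((k : ℝ) + 1) * (θ * t) ≤ (k + 1) * blockEnd k :=
      mul_le_mul_of_nonneg_left hk.le (by positivity)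
    simp only [Nat.succ_eq_add_one] at h2
    nlinarith
  by_cases hall : ∀ k ∈ Finset.range n, block φ α k t - block φ α k (θ * t) = 0
  · rw [Finset.sum_eq_zero hall]
    have := mul_nonneg ha0.le ht1
    linarith
  · push Not at hall
    obtain ⟨k, hkn, hk⟩ := hall
    rw [Finset.sum_eq_single_of_mem k hkn]
    · linarith [hbound k]
    · intro l _ hlk
      by_contra hl
      obtain ⟨hk1, hk2⟩ := hzero k hk
      obtain ⟨hl1, hl2⟩ := hzero l hl
      rcases lt_or_gt_of_ne hlk with h | h
      · exact hdisj l k h hk1 hl2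
      · exact hdisj k l h hl1 hk2

theorem nonpos_of_forall_mul_le {x M : ℝ} {K : ℕ} (u : ℕ → ℝ) (hu : ∀ k : ℕ, (k : ℝ) ≤ u k)
    (h : ∀ k, K ≤ k → x * u k ≤ M) : x ≤ 0 := by
  by_contra hx
  rw [not_le] at hx
  obtain ⟨n, hn⟩ := exists_nat_gt (M / x)
  rw [div_lt_iff₀ hx] at hn
  have h1 := h (max K n) (le_max_left _ _)
  have h2 := hu (max K n)
  have h3 : (n : ℝ) ≤ (max K n : ℕ) := by exact_mod_cast le_max_right K n
  nlinarith

theorem profile_spectrum_lower (hφ : φ ∈ classA d) {θ a M : ℝ} (hθ : θ ∈ Ioo (0 : ℝ) 1)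
    (h : ∀ t, 0 ≤ t → profile φ α t - profile φ α (θ * t) ≤ a * ((1 - θ) * t) + M) :
    φ θ ≤ a := by
  obtain ⟨h0, h1⟩ := hθ
  obtain ⟨K, hK⟩ := exists_nat_ge (1 / θ)
  have : (φ θ - a) * (1 - θ) ≤ 0 := by
    refine nonpos_of_forall_mul_le (K := K) (M := M) blockTop
      (fun k => by linarith [le_blockTop k]) fun k hk => ?_
    have hk' : 1 / ((k : ℝ) + 1) ≤ θ := by
      rw [div_le_comm₀ (by positivity) h0]
      have : (K : ℝ) ≤ k := by exact_mod_cast hk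
      linarith
    have hp := blockTop_pos k
    have e := block_blockTop_sub (φ := φ) (α := α) k hk' h1
    have e2 := block_sub_le_profile_sub hφ α k (s := θ * blockTop k) (t := blockTop k)
      (by nlinarith)
    have e3 := h _ hp.le
    rw [e, incr] at e2
    linarith
  nlinarith

theorem profile_dim_upper (hφ : φ ∈ classA d) (hφ₁ : ∀ θ ∈ Ioo (0 : ℝ) 1, φ θ ≤ φ₁)
    (hα : φ₁ ≤ α) {a : ℝ} (hα0 : 0 ≤ α) (ha : α < a) :
    ∃ M, ∀ s t, s ≤ t → profile φ α t - profile φ α s ≤ a * (t - s) + M := by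
  have ha0 : 0 < a := hα0.trans_lt ha
  obtain ⟨K, hK⟩ := exists_nat_ge (1 / a)
  set b := blockEnd K
  refine ⟨profile φ α b, fun s t hst => ?_⟩
  -- Pushing both points beyond b costs at most the value of the profile at b.
  have key := profile_sub_le_of_ge hφ hφ₁ hα (a := a) (b := b) (s := max s b) (t := max t b)
    (fun k hk => ?_) ha0.le (le_max_right _ _) (max_le_max hst le_rfl)
  · have h1 := profile_mono hφ α (le_max_left t b)
    have h2 : profile φ α (max s b) ≤ profile φ α s + profile φ α b := by
      rcases max_choice s b with h | h <;> rw [h] <;>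
        linarith [profile_nonneg hφ α s, profile_nonneg hφ α b]
    have h3 : max t b - max s b ≤ t - s := by
      have := max_sub_max_le_max t b s b
      rw [sub_self, max_eq_left (sub_nonneg.2 hst)] at this
      exact this
    have h4 := mul_le_mul_of_nonneg_left h3 ha0.le
    linarith
  · refine max_le ha.le ?_
    have hKk : K ≤ k := by
      by_contra h
      exact absurd (blockEnd_mono (le_of_not_ge h)) (not_le.2 hk)
    rw [div_le_comm₀ (by positivity) ha0]
    have : (K : ℝ) ≤ k := by exact_mod_cast hKk
    linarith

/-- The segment of block k gains at least α(k+1) over length k+1, so the constant M becomes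
negligible. -/
theorem profile_dim_lower (hφ : φ ∈ classA d) {a M : ℝ}
    (h : ∀ s t, 0 ≤ s → s < t → profile φ α t - profile φ α s ≤ a * (t - s) + M) : α ≤ a := by
  rw [← sub_nonpos]
  refine nonpos_of_forall_mul_le (K := 0) (M := M) (fun k => (k : ℝ) + 1)
    (fun k => by linarith) fun k _ => ?_
  have hk : (0 : ℝ) < k + 1 := by positivity
  have e1 := block_blockEnd_sub (φ := φ) (α := α) k
  have e2 := block_sub_le_profile_sub hφ α k (blockTop_le_blockEnd k)
  have e4 : blockEnd k - blockTop k = k + 1 := by simp [blockEnd]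
  have e3 := h _ _ (blockTop_pos k).le (by linarith : blockTop k < blockEnd k)
  have e5 := mul_le_mul_of_nonneg_right (le_max_left α (1 / ((k : ℝ) + 1))) hk.le
  rw [e4] at e3
  linarith

theorem profile_lipschitz (hφ : φ ∈ classA d) (hφ₁ : ∀ θ ∈ Ioo (0 : ℝ) 1, φ θ ≤ φ₁)
    (hα : φ₁ ≤ α) {D : ℝ} (hαD : α ≤ D) (hD : 1 ≤ D) {s t : ℝ} (hst : s ≤ t) :
    profile φ α t - profile φ α s ≤ D * (t - s) :=
  profile_sub_le_of_ge hφ hφ₁ hα (b := s)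
    (fun k _ => max_le hαD ((inv_succ_mem k).2.trans hD)) (by linarith) le_rfl hst

end

/-! ### Cubes and corners of a homogeneous Moran set -/

/-- The side length of the cubes of level `n`. -/
noncomputable def sideLength (r : ℕ → ℝ) (n : ℕ) : ℝ := ∏ i ∈ Finset.range n, r i

/-- The corner of the cube of a word that is nearest to the origin. -/
noncomputable def corner {d : ℕ} (r : ℕ → ℝ) {n : ℕ} (σ : Fin n → (Fin d → Bool)) : E d :=
  wordMap r n σ 0

theorem sideLength_succ (r : ℕ → ℝ) (n : ℕ) :
    sideLength r (n + 1) = sideLength r n * r n := Finset.prod_range_succ _ _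

theorem sideLength_pos {r : ℕ → ℝ} (hr : ∀ n, r n ∈ Ioc (0 : ℝ) (1 / 2)) (n : ℕ) :
    0 < sideLength r n := Finset.prod_pos fun i _ => (hr i).1

theorem sideLength_anti {r : ℕ → ℝ} (hr : ∀ n, r n ∈ Ioc (0 : ℝ) (1 / 2)) :
    Antitone (sideLength r) := by
  refine antitone_nat_of_succ_le fun n => ?_
  rw [sideLength_succ]
  nlinarith [sideLength_pos hr n, (hr n).2]

theorem moranMap_apply {d : ℕ} (ρ : ℝ) (i : Fin d → Bool) (x : E d) (j : Fin d) :
    moranMap ρ i x j = ρ * x j + if i j then 1 - ρ else 0 := by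
  simp [moranMap]

theorem wordMap_apply {d : ℕ} (r : ℕ → ℝ) (n : ℕ) (σ : Fin n → (Fin d → Bool)) (x : E d)
    (j : Fin d) : wordMap r n σ x j = sideLength r n * x j + corner r σ j := by
  induction n generalizing x with
  | zero => simp [wordMap, corner, sideLength]
  | succ n ih =>
    simp only [corner] at ih ⊢
    simp only [wordMap, Function.comp]
    rw [ih, ih (Fin.init σ) (moranMap _ _ 0), moranMap_apply, moranMap_apply, sideLength_succ]
    simp only [PiLp.zero_apply]
    ring

theorem corner_succ {d : ℕ} (r : ℕ → ℝ) (n : ℕ) (σ : Fin (n + 1) → (Fin d → Bool)) (j : Fin d) :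
    corner r σ j = corner r (Fin.init σ) j +
      if σ (Fin.last n) j then sideLength r n - sideLength r (n + 1) else 0 := by
  have : corner r σ j = wordMap r n (Fin.init σ) (moranMap (r n) (σ (Fin.last n)) 0) j := rfl
  rw [this, wordMap_apply, moranMap_apply, sideLength_succ]
  split_ifs <;> simp
  ring

theorem corner_apply_congr {d : ℕ} (r : ℕ → ℝ) {n : ℕ} {σ τ : Fin n → (Fin d → Bool)} {j : Fin d}
    (h : ∀ i, σ i j = τ i j) : corner r σ j = corner r τ j := by
  induction n with
  | zero => rw [Subsingleton.elim σ τ]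
  | succ n ih =>
    rw [corner_succ, corner_succ, h,
      ih (σ := Fin.init σ) (τ := Fin.init τ) (fun i => h i.castSucc)]

/-- Ratios at most 1/2 make the two shifts at each level at least a side length apart, and later
letters move a corner only within its cube. -/
theorem sideLength_le_abs_corner_sub {d : ℕ} {r : ℕ → ℝ} (hr : ∀ n, r n ∈ Ioc (0 : ℝ) (1 / 2))
    {n : ℕ} {σ τ : Fin n → (Fin d → Bool)} {j : Fin d} (h : ∃ i, σ i j ≠ τ i j) :
    sideLength r n ≤ |corner r σ j - corner r τ j| := by
  induction n with
  | zero => exact h.choose.elim0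
  | succ n ih =>
    rw [corner_succ, corner_succ]
    have hp := sideLength_pos hr (n + 1)
    have h2 : 2 * sideLength r (n + 1) ≤ sideLength r n := by
      rw [sideLength_succ]
      nlinarith [sideLength_pos hr n, (hr n).2]
    by_cases h' : ∃ i, Fin.init σ i j ≠ Fin.init τ i j
    · have := ih h'
      rw [le_abs] at this ⊢
      rcases this with h | h
      · left
        split_ifs <;> linarith
      · right
        split_ifs <;> linarith
    · have hinit : corner r (Fin.init σ) j = corner r (Fin.init τ) j := by
        push Not at h'
        exact corner_apply_congr r h'
      push Not at h'
      obtain ⟨i, hi⟩ := h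
      have hlast : σ (Fin.last n) j ≠ τ (Fin.last n) j := by
        induction i using Fin.lastCases with
        | last => exact hi
        | cast i => exact absurd (h' i) hi
      rw [hinit, le_abs]
      cases h1 : σ (Fin.last n) j <;> cases h3 : τ (Fin.last n) j <;> simp [h1, h3] at hlast ⊢
      · right; linarith
      · left; linarith

open Classical in
/-- Boundedly many cubes of a given level have corners close to a given point. -/
theorem card_corner_near_le {d : ℕ} {r : ℕ → ℝ} (hr : ∀ n, r n ∈ Ioc (0 : ℝ) (1 / 2)) (n : ℕ)
    (x : E d) : (Finset.univ.filter fun σ : Fin n → (Fin d → Bool) =>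
      ∀ j, |corner r σ j - x j| ≤ 2 * sideLength r n).card ≤ 5 ^ d := by
  have hp := sideLength_pos hr n
  have hcard : (Fintype.piFinset fun _ : Fin d => Finset.Icc (-2 : ℤ) 2).card = 5 ^ d := by
    simp
  rw [← hcard]
  -- Rescaled offsets lie in [-2,2], hence five floors per coordinate. Distinct words differ by a
  -- full side length in some coordinate, so their floor vectors differ.
  refine Finset.card_le_card_of_injOn
    (fun σ j => ⌊(corner r σ j - x j) / sideLength r n⌋) ?_ ?_
  · intro σ hσ
    simp only [Finset.coe_filter, Finset.mem_univ, true_and, mem_ofPred_eq] at hσ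
    simp only [Finset.mem_coe, Fintype.mem_piFinset, Finset.mem_Icc]
    intro j
    have := abs_le.1 (hσ j)
    constructor
    · rw [Int.le_floor, le_div_iff₀ hp]
      push_cast
      linarith
    · rw [← Int.lt_add_one_iff, Int.floor_lt, div_lt_iff₀ hp]
      push_cast
      linarith
  · intro σ _ τ _ h
    by_contra hne
    obtain ⟨i, hi⟩ := Function.ne_iff.1 hne
    obtain ⟨j, hj⟩ := Function.ne_iff.1 hi
    have h1 := sideLength_le_abs_corner_sub hr ⟨i, hj⟩
    have h2 := Int.abs_sub_lt_one_of_floor_eq_floor (congrFun h j)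
    rw [← sub_div, abs_div, abs_of_pos hp, div_lt_one hp] at h2
    simp only [sub_sub_sub_cancel_right] at h2
    linarith

theorem corner_prefix {d : ℕ} {r : ℕ → ℝ} (hr : ∀ n, r n ∈ Ioc (0 : ℝ) (1 / 2)) {n m : ℕ}
    (h : n ≤ m) (σ : Fin m → (Fin d → Bool)) (j : Fin d) :
    corner r (fun i => σ (Fin.castLE h i)) j ≤ corner r σ j ∧
      corner r σ j ≤ corner r (fun i => σ (Fin.castLE h i)) j
        + (sideLength r n - sideLength r m) := by
  induction m, h using Nat.le_induction with
  | base => simp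
  | succ m h ih =>
    have := ih (Fin.init σ)
    have e : (fun i => Fin.init σ (Fin.castLE h i)) =
        fun i => σ (Fin.castLE (h.trans m.le_succ) i) := rfl
    rw [e] at this
    rw [corner_succ]
    have := sideLength_anti hr m.le_succ
    simp only [Nat.succ_eq_add_one] at this
    split_ifs <;> constructor <;> linarith

/-- The union of the cubes of level `n`. -/
def level (d : ℕ) (r : ℕ → ℝ) (n : ℕ) : Set (E d) :=
  ⋃ σ : Fin n → (Fin d → Bool), wordMap r n σ '' unitCube d

theorem level_anti {d : ℕ} {r : ℕ → ℝ} (hr : ∀ n, r n ∈ Ioc (0 : ℝ) (1 / 2)) :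
    Antitone (level d r) := by
  refine antitone_nat_of_succ_le fun n => ?_
  refine iUnion_subset fun σ => ?_
  rintro _ ⟨y, hy, rfl⟩
  refine mem_iUnion.2 ⟨Fin.init σ, moranMap (r n) (σ (Fin.last n)) y, fun j => ?_, rfl⟩
  rw [moranMap_apply]
  have h1 := (hr n).1
  have h2 := (hr n).2
  have h3 := hy j
  constructor
  · split_ifs <;> nlinarith [h3.1, h3.2]
  · split_ifs <;> nlinarith [h3.1, h3.2]

theorem moranSet_subset_level {d : ℕ} {r : ℕ → ℝ} (hr : ∀ n, r n ∈ Ioc (0 : ℝ) (1 / 2)) (n : ℕ) :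
    moranSet d r ⊆ level d r n :=
  fun _ hx => level_anti hr n.le_succ (mem_iInter.1 hx n)

/-- Appending the zero letter fixes the corner, so corners survive at all deeper levels. -/
theorem corner_mem_level {d : ℕ} {r : ℕ → ℝ} {n m : ℕ} (h : n ≤ m)
    (σ : Fin n → (Fin d → Bool)) : corner r σ ∈ level d r m := by
  have : ∃ τ : Fin m → (Fin d → Bool), corner r τ = corner r σ := by
    induction m, h using Nat.le_induction with
    | base => exact ⟨σ, rfl⟩
    | succ m h ih =>
      obtain ⟨τ, hτ⟩ := ih
      refine ⟨Fin.snoc (α := fun _ => Fin d → Bool) τ (fun _ => false), ?_⟩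
      ext j
      rw [corner_succ, Fin.init_snoc, hτ]
      simp
  obtain ⟨τ, hτ⟩ := this
  exact mem_iUnion.2 ⟨τ, 0, fun j => by simp, hτ⟩

theorem corner_mem_moranSet {d : ℕ} {r : ℕ → ℝ} (hr : ∀ n, r n ∈ Ioc (0 : ℝ) (1 / 2)) {n : ℕ}
    (σ : Fin n → (Fin d → Bool)) : corner r σ ∈ moranSet d r :=
  mem_iInter.2 fun k => level_anti hr (le_max_left (k + 1) n) (corner_mem_level (le_max_right _ _) σ)

theorem zero_mem_moranSet {d : ℕ} {r : ℕ → ℝ} (hr : ∀ n, r n ∈ Ioc (0 : ℝ) (1 / 2)) :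
    (0 : E d) ∈ moranSet d r :=
  corner_mem_moranSet hr (n := 0) (fun _ _ => false)

theorem norm_le_sqrt_mul {d : ℕ} {x : E d} {R : ℝ} (hR : 0 ≤ R) (h : ∀ j, |x j| ≤ R) :
    ‖x‖ ≤ √d * R := by
  rw [EuclideanSpace.norm_eq]
  calc √(∑ i, ‖x i‖ ^ 2) ≤ √(∑ _i : Fin d, R ^ 2) := by
        refine Real.sqrt_le_sqrt (Finset.sum_le_sum fun i _ => ?_)
        exact pow_le_pow_left₀ (norm_nonneg _) (h i) 2
    _ = √d * R := by
        rw [Finset.sum_const, Finset.card_univ, Fintype.card_fin, nsmul_eq_mul,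
          Real.sqrt_mul (by positivity), Real.sqrt_sq hR]

theorem abs_apply_sub_lt {d : ℕ} {x y : E d} {δ : ℝ} (h : x ∈ Metric.ball y δ) (j : Fin d) :
    |x j - y j| < δ := by
  have := PiLp.norm_apply_le (x - y) j
  rw [Metric.mem_ball, dist_eq_norm] at h
  exact (by simpa using this : |x j - y j| ≤ ‖x - y‖).trans_lt h

/-! ### Covering numbers of Moran sets -/

theorem coverNum_le {d : ℕ} {δ : ℝ} {F : Set (E d)} {t : Finset (E d)}
    (h : F ⊆ ⋃ x ∈ t, Metric.ball x δ) : coverNum δ F ≤ t.card :=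
  Nat.sInf_le ⟨t, rfl, h⟩

-- Level-m cubes meeting the ball descend from at most 5^d level-n cubes near x, each with
-- 2^(d(m-n)) descendants. Level 0 is a single cube, so there δ is unrestricted.
open Classical in
theorem coverNum_moranSet_le {d : ℕ} {r : ℕ → ℝ} (hr : ∀ n, r n ∈ Ioc (0 : ℝ) (1 / 2)) {n m : ℕ}
    (hnm : n ≤ m) {δ δ' : ℝ} (hn : n = 0 ∨ δ ≤ sideLength r n) (hm : √d * sideLength r m < δ')
    (x : E d) :
    coverNum δ' (moranSet d r ∩ Metric.ball x δ) ≤ 5 ^ d * 2 ^ (d * (m - n)) := by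
  set W : Finset (Fin n → (Fin d → Bool)) := Finset.univ.filter fun τ =>
    n = 0 ∨ ∀ j, |corner r τ j - x j| ≤ 2 * sideLength r n with hWdef
  have hW : W.card ≤ 5 ^ d := by
    rcases n.eq_zero_or_pos with rfl | h0
    · exact (Finset.card_le_one_of_subsingleton W).trans (Nat.one_le_pow _ _ (by norm_num))
    · simpa [hWdef, h0.ne'] using card_corner_near_le hr n x
  set V : Finset (Fin m → (Fin d → Bool)) := Finset.univ.filter fun σ =>
    (fun i => σ (Fin.castLE hnm i)) ∈ W
  have hV : V.card ≤ 5 ^ d * 2 ^ (d * (m - n)) := by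
    have h1 : V.card ≤ (W ×ˢ (Finset.univ : Finset (Fin (m - n) → (Fin d → Bool)))).card := by
      refine Finset.card_le_card_of_injOn
        (fun σ => (fun i => σ (Fin.castLE hnm i), fun i => σ ⟨n + i, by omega⟩)) ?_ ?_
      · intro σ hσ
        simpa [V] using hσ
      · intro σ _ τ _ h
        simp only [Prod.mk.injEq] at h
        ext1 i
        by_cases hi : (i : ℕ) < n
        · exact congrFun h.1 ⟨i, hi⟩
        · have := congrFun h.2 ⟨i - n, by omega⟩
          simpa [Nat.add_sub_cancel' (not_lt.1 hi)] using this
    rw [Finset.card_product] at h1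
    have h2 : (Finset.univ : Finset (Fin (m - n) → (Fin d → Bool))).card = 2 ^ (d * (m - n)) := by
      simp [pow_mul]
    rw [h2] at h1
    exact h1.trans (Nat.mul_le_mul_right _ hW)
  refine (coverNum_le (t := V.image (corner r)) ?_).trans (Finset.card_image_le.trans hV)
  rintro y ⟨hy, hyx⟩
  obtain ⟨σ, z, hz, rfl⟩ := mem_iUnion.1 (moranSet_subset_level hr m hy)
  have hpm := sideLength_pos hr m
  simp only [Finset.mem_image, mem_iUnion]
  refine ⟨corner r σ, ⟨σ, ?_, rfl⟩, ?_⟩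
  · simp only [V, W, Finset.mem_filter, Finset.mem_univ, true_and]
    refine hn.imp_right fun hn j => ?_
    have h1 := abs_apply_sub_lt hyx j
    rw [wordMap_apply] at h1
    have h2 := corner_prefix hr hnm σ j
    have h3 := hz j
    rw [abs_lt] at h1
    rw [abs_le]
    have h4 : 0 ≤ sideLength r m * z j := mul_nonneg hpm.le h3.1
    have h5 : sideLength r m * z j ≤ sideLength r m := mul_le_of_le_one_right hpm.le h3.2
    constructor <;> linarith [sideLength_pos hr n]
  · rw [Metric.mem_ball, dist_eq_norm]
    refine (norm_le_sqrt_mul hpm.le fun j => ?_).trans_lt hm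
    have h3 := hz j
    rw [PiLp.sub_apply, wordMap_apply, add_sub_cancel_right,
      abs_of_nonneg (mul_nonneg hpm.le h3.1)]
    exact mul_le_of_le_one_right hpm.le h3.2

theorem corner_false {d : ℕ} (r : ℕ → ℝ) (n : ℕ) (j : Fin d) :
    corner r (fun (_ : Fin n) (_ : Fin d) => false) j = 0 := by
  induction n with
  | zero => simp [corner, wordMap]
  | succ n ih =>
    rw [corner_succ]
    simpa [Fin.init_def] using ih

-- The level-m descendants of the level-n cube at the origin have corners in the set and in the
-- ball; a ball of radius δ' catches at most 5^d of them.
open Classical in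
theorem le_coverNum_moranSet {d : ℕ} {r : ℕ → ℝ} (hr : ∀ n, r n ∈ Ioc (0 : ℝ) (1 / 2)) {n m : ℕ}
    (hnm : n ≤ m) {δ δ' : ℝ} (hδ' : 0 < δ') (hn : √d * sideLength r n < δ)
    (hm : δ' ≤ sideLength r m) :
    2 ^ (d * (m - n)) ≤ coverNum δ' (moranSet d r ∩ Metric.ball 0 δ) * 5 ^ d := by
  obtain ⟨t, htcard, ht⟩ := exists_cover hδ'
    (Metric.isBounded_ball.subset (inter_subset_right (s := moranSet d r)
      (t := Metric.ball (0 : E d) δ)))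
  rw [← htcard]
  set Z : Finset (Fin m → (Fin d → Bool)) := Finset.univ.filter fun σ =>
    (fun i => σ (Fin.castLE hnm i)) = fun _ _ => false
  have hZ : 2 ^ (d * (m - n)) ≤ Z.card := by
    have h2 : (Finset.univ : Finset (Fin (m - n) → (Fin d → Bool))).card = 2 ^ (d * (m - n)) := by
      simp [pow_mul]
    rw [← h2]
    refine Finset.card_le_card_of_injOn (fun υ i =>
      if h : (i : ℕ) < n then fun _ => false else υ ⟨i - n, by omega⟩) ?_ ?_
    · intro υ _
      simp [Z]
    · intro υ _ υ' _ h
      ext1 i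
      have := congrFun h ⟨n + i, by omega⟩
      simpa using this
  refine hZ.trans ?_
  have hsub : Z ⊆ t.biUnion fun y => Finset.univ.filter fun σ : Fin m → (Fin d → Bool) =>
      ∀ j, |corner r σ j - y j| ≤ 2 * sideLength r m := by
    intro σ hσ
    simp only [Z, Finset.mem_filter, Finset.mem_univ, true_and] at hσ
    have hmem : corner r σ ∈ moranSet d r ∩ Metric.ball 0 δ := by
      refine ⟨corner_mem_moranSet hr σ, ?_⟩
      rw [mem_ball_zero_iff]
      refine (norm_le_sqrt_mul (sideLength_pos hr n).le fun j => ?_).trans_lt hn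
      have := corner_prefix hr hnm σ j
      rw [hσ, corner_false] at this
      rw [abs_of_nonneg this.1]
      linarith [sideLength_pos hr m]
    obtain ⟨y, hy, hball⟩ := mem_iUnion₂.1 (ht hmem)
    simp only [Finset.mem_biUnion, Finset.mem_filter, Finset.mem_univ, true_and]
    refine ⟨y, hy, fun j => ?_⟩
    linarith [abs_apply_sub_lt hball j, sideLength_pos hr m]
  exact (Finset.card_le_card hsub).trans
    (Finset.card_biUnion_le_card_mul _ _ _ fun y _ => card_corner_near_le hr m y)

theorem one_le_coverNum {d : ℕ} {δ : ℝ} (hδ : 0 < δ) {F : Set (E d)} (hF : Bornology.IsBounded F)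
    (hne : F.Nonempty) : 1 ≤ coverNum δ F := by
  obtain ⟨t, htcard, ht⟩ := exists_cover hδ hF
  obtain ⟨x, hx⟩ := hne
  obtain ⟨y, hy, -⟩ := mem_iUnion₂.1 (ht hx)
  rw [← htcard]
  exact Finset.card_pos.2 ⟨y, hy⟩

theorem two_pow_eq_exp {d n m : ℕ} (h : n ≤ m) :
    ((2 : ℝ) ^ (d * (m - n))) = Real.exp (m * (d * Real.log 2) - n * (d * Real.log 2)) := by
  rw [← Real.exp_log (by positivity : (0 : ℝ) < 2 ^ (d * (m - n))), Real.log_pow]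
  congr 1
  push_cast [Nat.cast_sub h]
  ring

/-- Covering numbers of the Moran set whose cubes have side lengths `exp (-τ n)`, where the
profile `f` takes the value `n d log 2` at `τ n`. -/
theorem exists_moranSet_of_profile {d : ℕ} (hd : 1 ≤ d) {f : ℝ → ℝ} (hmono : Monotone f)
    (hf0 : ∀ t ≤ 0, f t = 0) (hlip : ∀ s t, s ≤ t → f t - f s ≤ d * (t - s))
    (htop : Tendsto f atTop atTop) :
    ∃ r : ℕ → ℝ, (∀ n, r n ∈ Ioc (0 : ℝ) (1 / 2)) ∧ ∃ M : ℝ, 0 < M ∧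
      (∀ s t, s ≤ t → ∀ x : E d, (coverNum (Real.exp (-t))
        (moranSet d r ∩ Metric.ball x (Real.exp (-s))) : ℝ) ≤ M * Real.exp (f t - f s)) ∧
      (∀ s t, 0 ≤ s → s ≤ t → Real.exp (f t - f s) ≤ M * (coverNum (Real.exp (-t))
        (moranSet d r ∩ Metric.ball 0 (Real.exp (-s))) : ℝ)) := by
  have hdR : (1 : ℝ) ≤ d := by exact_mod_cast hd
  set c : ℝ := d * Real.log 2 with hc
  have hlog2 : 0 < Real.log 2 := Real.log_pos (by norm_num)
  have hcpos : 0 < c := by positivity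
  have hcont : Continuous f := by
    refine (LipschitzWith.of_le_add_mul (d : NNReal) fun x y => ?_).continuous
    rcases le_total x y with h | h
    · have := hmono h
      have : 0 ≤ ((d : NNReal) : ℝ) * dist x y := by positivity
      linarith
    · have := hlip y x h
      rw [Real.dist_eq, abs_of_nonneg (sub_nonneg.2 h)]
      push_cast
      linarith
  -- Since f may be flat near 0, τ 0 = 0 is imposed; it matches the side length 1 of level 0.
  have hex : ∀ n : ℕ, ∃ t, f t = n * c ∧ (n = 0 → t = 0) := by
    intro n
    rcases n.eq_zero_or_pos with rfl | hn
    · exact ⟨0, by simp [hf0 0 le_rfl], fun _ => rfl⟩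
    · obtain ⟨T, hT0, hT⟩ := ((eventually_ge_atTop (0 : ℝ)).and
        (htop.eventually_ge_atTop (n * c))).exists
      obtain ⟨t, -, ht⟩ := intermediate_value_Icc hT0 hcont.continuousOn
        (⟨by rw [hf0 0 le_rfl]; positivity, hT⟩ : (n : ℝ) * c ∈ Icc (f 0) (f T))
      exact ⟨t, ht, fun h => absurd h hn.ne'⟩
  choose τ hτ hτ0 using hex
  have hτz : τ 0 = 0 := hτ0 0 rfl
  -- Between consecutive τ the function gains d log 2 at slope at most d, whence the ratios are at
  -- most 1/2.
  have hstep : ∀ n, Real.log 2 ≤ τ (n + 1) - τ n := by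
    intro n
    have hlt : f (τ n) < f (τ (n + 1)) := by
      rw [hτ, hτ]
      push_cast
      linarith
    have h1 := hlip _ _ (hmono.reflect_lt hlt).le
    rw [hτ, hτ] at h1
    push_cast at h1
    have h2 : d * Real.log 2 ≤ d * (τ (n + 1) - τ n) := by linarith
    exact le_of_mul_le_mul_left h2 (by linarith)
  set r : ℕ → ℝ := fun n => Real.exp (τ n - τ (n + 1)) with hrdef
  have hr : ∀ n, r n ∈ Ioc (0 : ℝ) (1 / 2) := by
    refine fun n => ⟨Real.exp_pos _, ?_⟩
    have : (1 / 2 : ℝ) = Real.exp (-Real.log 2) := by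
      rw [Real.exp_neg, Real.exp_log (by norm_num), one_div]
    rw [this]
    exact Real.exp_le_exp.2 (by linarith [hstep n])
  have hside : ∀ n, sideLength r n = Real.exp (-τ n) := by
    intro n
    induction n with
    | zero => simp [sideLength, hτz]
    | succ n ih =>
      rw [sideLength_succ, ih, hrdef, ← Real.exp_add]
      ring_nf
  -- A shift by q absorbs the diameter factor √d; the added 1 gives the strict inequality needed for
  -- open balls.
  set q : ℝ := Real.log (√d + 1) with hq
  have hsq : 0 ≤ √(d : ℝ) := Real.sqrt_nonneg _
  have hq0 : 0 ≤ q := Real.log_nonneg (by linarith)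
  have hsmall : ∀ n s, s + q ≤ τ n → √d * sideLength r n < Real.exp (-s) := by
    intro n s h
    rw [hside]
    calc √(d : ℝ) * Real.exp (-τ n) < (√d + 1) * Real.exp (-τ n) :=
          mul_lt_mul_of_pos_right (by linarith) (Real.exp_pos _)
      _ = Real.exp (q + -τ n) := by rw [Real.exp_add, hq, Real.exp_log (by linarith)]
      _ ≤ Real.exp (-s) := Real.exp_le_exp.2 (by linarith)
  have hfnn : ∀ t, 0 ≤ f t := by
    intro t
    rw [← hf0 (min t 0) (min_le_right _ _)]
    exact hmono (min_le_left _ _)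
  have hfq : ∀ t, f (t + q) ≤ f t + d * q := by
    intro t
    have := hlip t (t + q) (by linarith)
    rw [add_sub_cancel_left] at this
    linarith
  -- the first level below scale `exp (-t)`, and the last one above it
  set up : ℝ → ℕ := fun t => ⌊f t / c⌋₊ + 1 with hup
  set dn : ℝ → ℕ := fun t => ⌊f t / c⌋₊ - 1 with hdn
  have hup1 : ∀ t, t ≤ τ (up t) := by
    intro t
    refine (hmono.reflect_lt ?_).le
    rw [hτ, ← div_lt_iff₀ hcpos]
    simpa [hup] using Nat.lt_floor_add_one (f t / c)
  have hup2 : ∀ t, (up t : ℝ) * c ≤ f t + c := by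
    intro t
    have := Nat.floor_le (div_nonneg (hfnn t) hcpos.le)
    rw [le_div_iff₀ hcpos] at this
    simp only [hup]
    push_cast
    linarith
  -- The -1 in `dn` makes the comparison of f-values strict; f has flat stretches, so equal values
  -- would not order the arguments.
  have hdn1 : ∀ t, dn t = 0 ∨ τ (dn t) ≤ t := by
    intro t
    rcases (dn t).eq_zero_or_pos with h | h
    · exact Or.inl h
    · right
      refine (hmono.reflect_lt ?_).le
      rw [hτ]
      have h1 := Nat.floor_le (div_nonneg (hfnn t) hcpos.le)
      rw [le_div_iff₀ hcpos] at h1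
      have h2 : ((dn t : ℕ) : ℝ) + 1 = (⌊f t / c⌋₊ : ℝ) := by
        have : dn t + 1 = ⌊f t / c⌋₊ := by
          simp only [hdn] at h ⊢
          omega
        exact_mod_cast this
      rw [← h2] at h1
      linarith
  have hdn2 : ∀ t, f t - 2 * c ≤ (dn t : ℝ) * c := by
    intro t
    have h1 := Nat.lt_floor_add_one (f t / c)
    rw [div_lt_iff₀ hcpos] at h1
    have h2 : (⌊f t / c⌋₊ : ℝ) ≤ dn t + 1 := by
      have : ⌊f t / c⌋₊ ≤ dn t + 1 := by
        simp only [hdn]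
        omega
      exact_mod_cast this
    nlinarith
  -- Rounding to levels costs c in `up` and 2c in `dn`, the shift costs d q, and 5^d is the packing
  -- constant.
  refine ⟨r, hr, 5 ^ d * Real.exp (3 * c + d * q), by positivity, ?_, ?_⟩
  · intro s t hst x
    have hle : dn s ≤ up (t + q) := by
      have : ⌊f s / c⌋₊ ≤ ⌊f (t + q) / c⌋₊ :=
        Nat.floor_le_floor (div_le_div_of_nonneg_right (hmono (by linarith)) hcpos.le)
      simp only [hdn, hup]
      omega
    have h1 := coverNum_moranSet_le hr hle (δ := Real.exp (-s)) (δ' := Real.exp (-t))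
      ((hdn1 s).imp_right fun h => by rw [hside]; exact Real.exp_le_exp.2 (by linarith))
      (hsmall _ _ (hup1 _)) x
    calc (coverNum (Real.exp (-t)) (moranSet d r ∩ Metric.ball x (Real.exp (-s))) : ℝ)
        ≤ 5 ^ d * 2 ^ (d * (up (t + q) - dn s)) := by exact_mod_cast h1
      _ ≤ 5 ^ d * Real.exp (3 * c + d * q + (f t - f s)) := by
          rw [two_pow_eq_exp hle, ← hc]
          gcongr
          linarith [hup2 (t + q), hdn2 s, hfq t]
      _ = _ := by rw [Real.exp_add, mul_assoc]
  · intro s t hs hst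
    have hexp : Real.exp (f t - f s) ≤
        Real.exp (3 * c + d * q) * Real.exp (dn t * c - up (s + q) * c) := by
      rw [← Real.exp_add]
      refine Real.exp_le_exp.2 ?_
      linarith [hup2 (s + q), hdn2 t, hfq s]
    refine hexp.trans ?_
    rw [mul_comm (5 ^ d : ℝ), mul_assoc]
    refine mul_le_mul_of_nonneg_left ?_ (Real.exp_pos _).le
    rcases le_or_gt (up (s + q)) (dn t) with hle | hlt
    · rw [hc, ← two_pow_eq_exp hle]
      have h1 := le_coverNum_moranSet hr hle (δ := Real.exp (-s)) (Real.exp_pos (-t))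
        (hsmall _ _ (hup1 _)) (by
          rw [hside]
          refine Real.exp_le_exp.2 ?_
          rcases hdn1 t with h | h
          · rw [h, hτz]
            linarith
          · linarith)
      rw [mul_comm (5 ^ d : ℝ)]
      exact_mod_cast h1
    -- With no level in between, the exponent is nonpositive and the point 0 alone suffices.
    · have h1 : Real.exp (dn t * c - up (s + q) * c) ≤ 1 := by
        rw [Real.exp_le_one_iff]
        have : (dn t : ℝ) ≤ up (s + q) := by exact_mod_cast hlt.le
        nlinarith
      have h2 : (1 : ℝ) ≤ coverNum (Real.exp (-t))
          (moranSet d r ∩ Metric.ball 0 (Real.exp (-s))) := by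
        exact_mod_cast one_le_coverNum (Real.exp_pos _) (Metric.isBounded_ball.subset
          inter_subset_right) ⟨0, zero_mem_moranSet hr, Metric.mem_ball_self (Real.exp_pos _)⟩
      have h3 : (1 : ℝ) ≤ 5 ^ d := one_le_pow₀ (by norm_num)
      nlinarith

/-! ### Reading off the dimensions from the profile -/

theorem iInf_coe_eq {S : Set ℝ} {a : ℝ} (h1 : ∀ b, a < b → b ∈ S) (h2 : ∀ b ∈ S, a ≤ b) :
    ⨅ b ∈ S, (b : EReal) = a := by
  refine le_antisymm ?_ (le_iInf₂ fun b hb => EReal.coe_le_coe_iff.2 (h2 b hb))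
  refine EReal.le_of_forall_lt_iff_le.1 fun b hb => ?_
  exact iInf₂_le b (h1 b (EReal.coe_lt_coe_iff.1 hb))

theorem exp_rpow_div {t θ a : ℝ} : (Real.exp (-t) / Real.exp (-t) ^ (1 / θ)) ^ a =
    Real.exp (a * (t / θ - t)) := by
  rw [← Real.exp_mul, ← Real.exp_sub, ← Real.exp_mul]
  ring_nf

/-- The Assouad spectrum is determined by a function describing the covering numbers. -/
theorem assouadSpectrum_eq {d : ℕ} {F : Set (E d)} {f : ℝ → ℝ} {M θ v : ℝ} (hM : 0 < M)
    (h0F : 0 ∈ F) (hθ : θ ∈ Ioo (0 : ℝ) 1)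
    (hupper : ∀ s t, s ≤ t → ∀ x : E d, (coverNum (Real.exp (-t))
        (F ∩ Metric.ball x (Real.exp (-s))) : ℝ) ≤ M * Real.exp (f t - f s))
    (hlower : ∀ s t, 0 ≤ s → s ≤ t → Real.exp (f t - f s) ≤ M * (coverNum (Real.exp (-t))
        (F ∩ Metric.ball 0 (Real.exp (-s))) : ℝ))
    (h1 : ∀ a, v < a → ∃ L, ∀ t, 0 ≤ t → f t - f (θ * t) ≤ a * ((1 - θ) * t) + L)
    (h2 : ∀ a L, (∀ t, 0 ≤ t → f t - f (θ * t) ≤ a * ((1 - θ) * t) + L) → v ≤ a) :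
    assouadSpectrum θ F = v := by
  obtain ⟨hθ0, hθ1⟩ := hθ
  refine iInf_coe_eq (fun a ha => ?_) fun a ha => ?_
  · obtain ⟨L, hL⟩ := h1 a ha
    refine ⟨M * Real.exp L, by positivity, fun δ hδ hδ1 x _ => ?_⟩
    obtain ⟨t, rfl⟩ : ∃ t, δ = Real.exp (-t) := ⟨-Real.log δ, by rw [neg_neg, Real.exp_log hδ]⟩
    have ht : 0 ≤ t := by simpa using hδ1
    rw [exp_rpow_div, ← Real.exp_mul]
    have hle : t ≤ t / θ := by
      rw [le_div_iff₀ hθ0]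
      nlinarith
    have e : -t * (1 / θ) = -(t / θ) := by ring
    rw [e]
    refine (hupper t (t / θ) hle x).trans ?_
    rw [mul_assoc, ← Real.exp_add]
    -- For δ = e^{-t} the small scale is e^{-t/θ}, so the window is [θT, T] with T = t/θ.
    have h3 := hL (t / θ) (by positivity)
    have e1 : θ * (t / θ) = t := by field_simp
    have e2 : (1 - θ) * (t / θ) = t / θ - t := by rw [sub_mul, e1, one_mul]
    rw [e1, e2] at h3
    have h4 : f (t / θ) - f t ≤ L + a * (t / θ - t) := by linarith
    gcongr
  · obtain ⟨L, hL, h⟩ := ha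
    refine h2 a (Real.log (M * L)) fun T hT => ?_
    have hle : θ * T ≤ T := by nlinarith
    have hs : 0 ≤ θ * T := by positivity
    have h3 := h (Real.exp (-(θ * T))) (Real.exp_pos _) (by simpa using hs) 0 h0F
    rw [exp_rpow_div, ← Real.exp_mul] at h3
    have e : -(θ * T) * (1 / θ) = -T := by field_simp
    have e2 : θ * T / θ - θ * T = (1 - θ) * T := by
      field_simp
    rw [e, e2] at h3
    have h4 := (hlower (θ * T) T hs hle).trans (mul_le_mul_of_nonneg_left h3 hM.le)
    rw [← mul_assoc, ← Real.exp_log (by positivity : 0 < M * L), ← Real.exp_add,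
      Real.exp_le_exp] at h4
    linarith

/-- The Assouad dimension is determined by a function describing the covering numbers. -/
theorem assouadDim_eq {d : ℕ} {F : Set (E d)} {f : ℝ → ℝ} {M v : ℝ} (hM : 0 < M)
    (h0F : 0 ∈ F)
    (hupper : ∀ s t, s ≤ t → ∀ x : E d, (coverNum (Real.exp (-t))
        (F ∩ Metric.ball x (Real.exp (-s))) : ℝ) ≤ M * Real.exp (f t - f s))
    (hlower : ∀ s t, 0 ≤ s → s ≤ t → Real.exp (f t - f s) ≤ M * (coverNum (Real.exp (-t))
        (F ∩ Metric.ball 0 (Real.exp (-s))) : ℝ))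
    (h1 : ∀ a, v < a → ∃ L, ∀ s t, s ≤ t → f t - f s ≤ a * (t - s) + L)
    (h2 : ∀ a L, (∀ s t, 0 ≤ s → s < t → f t - f s ≤ a * (t - s) + L) → v ≤ a) :
    assouadDim F = v := by
  have hpow : ∀ s t a : ℝ, (Real.exp (-s) / Real.exp (-t)) ^ a = Real.exp (a * (t - s)) := by
    intro s t a
    rw [← Real.exp_sub, ← Real.exp_mul]
    ring_nf
  refine iInf_coe_eq (fun a ha => ?_) fun a ha => ?_
  · obtain ⟨L, hL⟩ := h1 a ha
    refine ⟨M * Real.exp L, by positivity, fun δ' δ hδ' hδ x _ => ?_⟩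
    obtain ⟨t, rfl⟩ : ∃ t, δ' = Real.exp (-t) :=
      ⟨-Real.log δ', by rw [neg_neg, Real.exp_log hδ']⟩
    obtain ⟨s, rfl⟩ : ∃ t, δ = Real.exp (-t) :=
      ⟨-Real.log δ, by rw [neg_neg, Real.exp_log (hδ'.trans hδ)]⟩
    have hst : s ≤ t := by linarith [Real.exp_lt_exp.1 hδ]
    rw [hpow]
    refine (hupper s t hst x).trans ?_
    rw [mul_assoc, ← Real.exp_add]
    have h4 : f t - f s ≤ L + a * (t - s) := by linarith [hL s t hst]
    gcongr
  · obtain ⟨L, hL, h⟩ := ha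
    refine h2 a (Real.log (M * L)) fun s t hs hst => ?_
    have h3 := h (Real.exp (-t)) (Real.exp (-s)) (Real.exp_pos _)
      (Real.exp_lt_exp.2 (by linarith)) 0 h0F
    rw [hpow] at h3
    have h4 := (hlower s t hs hst.le).trans (mul_le_mul_of_nonneg_left h3 hM.le)
    rw [← mul_assoc, ← Real.exp_log (by positivity : 0 < M * L), ← Real.exp_add,
      Real.exp_le_exp] at h4
    linarith

/-! ### The case d = 0 -/

theorem coverNum_dim_zero {δ : ℝ} (hδ : 0 < δ) {F : Set (E 0)} (hF : F.Nonempty) :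
    coverNum δ F = 1 := by
  refine le_antisymm ?_ (one_le_coverNum hδ (toFinite F).isBounded hF)
  refine (coverNum_le (t := {0}) fun x _ => ?_).trans (by simp)
  rw [Subsingleton.elim x 0]
  simpa using hδ

theorem exists_moranSet_dim_zero {φ : ℝ → ℝ} (hφ : ∀ θ ∈ Ioo (0 : ℝ) 1, φ θ = 0) :
    ∃ C : Set (E 0), IsHomogeneousMoranSet C ∧ assouadDim C = ((0 : ℝ) : EReal) ∧
      ∀ θ ∈ Ioo (0 : ℝ) 1, assouadSpectrum θ C = (φ θ : EReal) := by
  have hr : ∀ n : ℕ, (fun _ : ℕ => (1 / 2 : ℝ)) n ∈ Ioc (0 : ℝ) (1 / 2) :=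
    fun _ => ⟨by norm_num, le_rfl⟩
  have h0 := zero_mem_moranSet (d := 0) hr
  have hupper : ∀ s t : ℝ, s ≤ t → ∀ x : E 0, (coverNum (Real.exp (-t))
      (moranSet 0 (fun _ => 1 / 2) ∩ Metric.ball x (Real.exp (-s))) : ℝ) ≤
        1 * Real.exp ((fun _ : ℝ => (0 : ℝ)) t - (fun _ : ℝ => (0 : ℝ)) s) := by
    intro s t _ x
    rw [coverNum_dim_zero (Real.exp_pos _)]
    · simp
    · refine ⟨0, h0, ?_⟩
      rw [Subsingleton.elim x 0]
      exact Metric.mem_ball_self (Real.exp_pos _)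
  have hlower : ∀ s t : ℝ, 0 ≤ s → s ≤ t →
      Real.exp ((fun _ : ℝ => (0 : ℝ)) t - (fun _ : ℝ => (0 : ℝ)) s) ≤
        1 * (coverNum (Real.exp (-t))
        (moranSet 0 (fun _ => 1 / 2) ∩ Metric.ball (0 : E 0) (Real.exp (-s))) : ℝ) := by
    intro s t _ _
    rw [coverNum_dim_zero (Real.exp_pos _)]
    · simp
    · exact ⟨0, h0, Metric.mem_ball_self (Real.exp_pos _)⟩
  refine ⟨_, ⟨_, hr, rfl⟩, ?_, fun θ hθ => ?_⟩
  · refine assouadDim_eq zero_lt_one h0 hupper hlower (fun a ha => ⟨0, fun s t hst => ?_⟩)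
      fun a L h => ?_
    · have := mul_nonneg ha.le (sub_nonneg.2 hst)
      linarith
    · have : -a ≤ 0 := by
        refine nonpos_of_forall_mul_le (K := 0) (M := L) (fun k => (k : ℝ) + 1)
          (fun k => by linarith) fun k _ => ?_
        have := h 0 (k + 1) le_rfl (by positivity)
        linarith
      linarith
  · rw [hφ θ hθ]
    obtain ⟨hθ0, hθ1⟩ := hθ
    refine assouadSpectrum_eq zero_lt_one h0 ⟨hθ0, hθ1⟩ hupper hlower
      (fun a ha => ⟨0, fun t ht => ?_⟩) fun a L h => ?_
    · have := mul_nonneg ha.le (mul_nonneg (sub_nonneg.2 hθ1.le) ht)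
      linarith
    · have : -(a * (1 - θ)) ≤ 0 := by
        refine nonpos_of_forall_mul_le (K := 0) (M := L) (fun k => (k : ℝ))
          (fun k => le_rfl) fun k _ => ?_
        have := h k (by positivity)
        linarith
      nlinarith

end AssouadSpectra

/-! ### The main theorem -/

open AssouadSpectra in
theorem theoremt (d : ℕ) (φ : ℝ → ℝ) (hφ : φ ∈ AssouadSpectra.classA d) :
    ∃ φ₁ : ℝ, Tendsto φ (𝓝[<] 1) (𝓝 φ₁) ∧
      ∀ α : ℝ, φ₁ ≤ α → α ≤ d →
        ∃ C : Set (AssouadSpectra.E d), AssouadSpectra.IsHomogeneousMoranSet C ∧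
          AssouadSpectra.assouadDim C = (α : EReal) ∧
          ∀ θ ∈ Ioo (0 : ℝ) 1, AssouadSpectra.assouadSpectrum θ C = (φ θ : EReal) := by
  obtain ⟨φ₁, hlim, hle⟩ := exists_limit_of_classA hφ
  refine ⟨φ₁, hlim, fun α hα hαd => ?_⟩
  have hhalf : (1 / 2 : ℝ) ∈ Ioo (0 : ℝ) 1 := ⟨by norm_num, by norm_num⟩
  have hα0 : 0 ≤ α := ((hφ.1 _ hhalf).1.trans (hle _ hhalf)).trans hα
  -- The segment of block 0 has slope at least 1, so the d-Lipschitz bound needs d ≥ 1.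
  rcases d.eq_zero_or_pos with rfl | hd
  · have hα' : α = 0 := le_antisymm (by simpa using hαd) hα0
    rw [hα']
    exact exists_moranSet_dim_zero fun θ hθ =>
      le_antisymm (by simpa using (hφ.1 θ hθ).2) (hφ.1 θ hθ).1
  · have hD : (1 : ℝ) ≤ d := by exact_mod_cast hd
    obtain ⟨r, hr, M, hM, hupper, hlower⟩ := exists_moranSet_of_profile hd (profile_mono hφ α)
      (fun t ht => profile_of_nonpos ht)
      (fun s t hst => profile_lipschitz hφ hle hα hαd hD hst) (profile_tendsto hφ α)
    have h0 := zero_mem_moranSet (d := d) hr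
    exact ⟨_, ⟨r, hr, rfl⟩,
      assouadDim_eq hM h0 hupper hlower (fun a ha => profile_dim_upper hφ hle hα hα0 ha)
        (fun a L h => profile_dim_lower hφ h),
      fun θ hθ => assouadSpectrum_eq hM h0 hθ hupper hlower
        (fun a ha => profile_spectrum_upper hφ hαd hD hθ ha)
        (fun a L h => profile_spectrum_lower hφ hθ h)⟩
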